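/- Let $\mathcal{T}$ be the set of terms built from variables $\mathsf{x}_1, \mathsf{x}_2, \dots$ and one constant $\mathbf{M}$ by a binary application (written as juxtaposition). Let $\Rightarrow$ be the smallest relation on $\mathcal{T}$ such that $\mathbf{M}\, s \Rightarrow s\, s$ for every term $s$, and such that $t_1 \Rightarrow t_1'$ implies $t_1 t_2 \Rightarrow t_1' t_2$ and $t_2 \Rightarrow t_2'$ implies $t_1 t_2 \Rightarrow t_1 t_2'$. Its reflexive and transitive closure $\preccurlyeq$ is a partial order on $\mathcal{T}$. Put $r_0 := \mathbf{M}$ and $r_d := \mathbf{M}\, r_{d-1}$ for $d \geq 1$. The Mockingbird lattice of order $d \geq 0$ is $\mathrm{M}(d) := \{t \in \mathcal{T} : r_d \preccurlyeq t\}$, ordered by $\preccurlyeq$. A duplicative forest is a finite (possibly empty) word of planar rooted trees each of whose nodes is black or white. Write $f \Rrightarrow f'$ if $f'$ is obtained from $f$ by selecting a white node, turning it black, and duplicating its sequence of descendants (if $g$ is the word of the subtrees of the node, it is replaced by $g\,g$). The reflexive and transitive closure $\ll$ of $\Rrightarrow$ is a partial order on duplicative forests. **Theorem.** For every duplicative forest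 $f$, the poset $\{f' : f \ll f'\}$, ordered by $\ll$, is isomorphic to a maximal interval of a Mockingbird lattice: there are $d \geq 0$ and $a, b \in \mathrm{M}(d)$ with $a \preccurlyeq b$ such that $b$ is the greatest element of $\mathrm{M}(d)$ and the posets $\{f' : f \ll f'\}$ and $[a, b] = \{t \in \mathrm{M}(d) : a \preccurlyeq t \preccurlyeq b\}$ are isomorphic. -/

import Mathlib

namespace Mockingbird

/-! ### Terms on the Mockingbird and their rewrite order -/

/-- Terms over the alphabet `{M}`: variables `x₁, x₂, …`, the basic combinator `M`, and
applications `(t₁ ⋆ t₂)`. -/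
inductive MTerm : Type
  | var (i : ℕ+) : MTerm
  | M : MTerm
  | app (t₁ t₂ : MTerm) : MTerm

namespace MTerm

/-- One rewrite step `t ⇒ t'`: the context closure of the rule `M x₁ → x₁ x₁`. -/
inductive Step : MTerm → MTerm → Prop
  | rule (s : MTerm) : Step (app M s) (app s s)
  | left {t₁ t₁' : MTerm} (t₂ : MTerm) (h : Step t₁ t₁') : Step (app t₁ t₂) (app t₁' t₂)
  | right (t₁ : MTerm) {t₂ t₂' : MTerm} (h : Step t₂ t₂') : Step (app t₁ t₂) (app t₁ t₂')

/-- A weight used only to show that the rewrite preorder is antisymmetric. -/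
def weight : MTerm → ℕ
  | var _ => 2
  | M => 1
  | app t₁ t₂ => weight t₁ + weight t₂

theorem one_le_weight (t : MTerm) : 1 ≤ t.weight := by
  induction t with
  | var i => simp [weight]
  | M => simp [weight]
  | app t₁ t₂ h₁ h₂ => simp only [weight]; omega

theorem eq_M_or_two_le_weight (t : MTerm) : t = M ∨ 2 ≤ t.weight := by
  cases t with
  | var i => simp [weight]
  | M => simp
  | app t₁ t₂ =>
    right
    have h₁ := one_le_weight t₁
    have h₂ := one_le_weight t₂
    simp only [weight]; omega

theorem Step.eq_or_weight_lt {t t' : MTerm} (h : Step t t') : t = t' ∨ t.weight < t'.weight := by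
  induction h with
  | rule s =>
    rcases eq_M_or_two_le_weight s with h | h
    · left; rw [h]
    · right; simp only [weight]; omega
  | left t₂ _ ih =>
    rcases ih with h | h
    · left; rw [h]
    · right; simp only [weight]; omega
  | right t₁ _ ih =>
    rcases ih with h | h
    · left; rw [h]
    · right; simp only [weight]; omega

theorem eq_or_weight_lt_of_reflTransGen {t t' : MTerm} (h : Relation.ReflTransGen Step t t') :
    t = t' ∨ t.weight < t'.weight := by
  induction h with
  | refl => exact Or.inl rfl
  | tail _ hs ih =>
    rcases ih with rfl | ih
    · exact hs.eq_or_weight_lt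
    · rcases hs.eq_or_weight_lt with rfl | hs
      · exact Or.inr ih
      · exact Or.inr (ih.trans hs)

/-- The poset `𝒫` of terms: `t ≤ t'` when `t'` is reached from `t` by finitely many
rewrite steps (reflexive and transitive closure of `⇒`). -/
instance : PartialOrder MTerm where
  le := Relation.ReflTransGen Step
  le_refl _ := Relation.ReflTransGen.refl
  le_trans _ _ _ h₁ h₂ := h₁.trans h₂
  le_antisymm t t' h₁ h₂ := by
    rcases eq_or_weight_lt_of_reflTransGen h₁ with h | h
    · exact h
    · rcases eq_or_weight_lt_of_reflTransGen h₂ with h' | h'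
      · exact h'.symm
      · omega

/-- The right comb combinator `r_d`: `r₀ = M` and `r_{d+1} = M r_d`. -/
def rightComb : ℕ → MTerm
  | 0 => M
  | d + 1 => app M (rightComb d)

end MTerm

/-- The Mockingbird lattice `M(d) = 𝒫(r_d)`: the subposet of all terms `t` with `r_d ≤ t`. -/
abbrev MockingbirdLattice (d : ℕ) : Type := Set.Ici (MTerm.rightComb d)

/-! ### Duplicative forests -/

/-- Colours of the nodes of duplicative trees. -/
inductive Color : Type
  | white : Color
  | black : Color

/-- Duplicative forests, that is, finite words of planar rooted trees with black or white nodes.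
A forest is either the empty word `nil`, or `cons c g f`: the word whose first tree has a root of
colour `c` with `g` as the forest (word) of its subtrees, and whose remaining trees form the
word `f`. -/
inductive DupForest : Type
  | nil : DupForest
  | cons (c : Color) (g f : DupForest) : DupForest

namespace DupForest

/-- Concatenation of forests. -/
def append : DupForest → DupForest → DupForest
  | nil, f' => f'
  | cons c g f, f' => cons c g (append f f')

/-- One step: a white node, anywhere in the forest, is turned into a black one and its sequence
of descendants (the forest `g` of its subtrees) is duplicated. -/
inductive Step : DupForest → DupForest → Prop
  | dup (g f : DupForest) : Step (cons Color.white g f) (cons Color.black (append g g) f)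
  | child (c : Color) {g g' : DupForest} (f : DupForest) (h : Step g g') :
      Step (cons c g f) (cons c g' f)
  | tail (c : Color) (g : DupForest) {f f' : DupForest} (h : Step f f') :
      Step (cons c g f) (cons c g f')

/-- Number of black nodes. -/
def blackCount : DupForest → ℕ
  | nil => 0
  | cons Color.white g f => blackCount g + blackCount f
  | cons Color.black g f => blackCount g + blackCount f + 1

theorem blackCount_append (f f' : DupForest) :
    (append f f').blackCount = f.blackCount + f'.blackCount := by
  induction f with
  | nil => simp [append, blackCount]
  | cons c g f _ ih => cases c <;> simp only [append, blackCount, ih] <;> omega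

theorem Step.blackCount_lt {f f' : DupForest} (h : Step f f') :
    f.blackCount < f'.blackCount := by
  induction h with
  | dup g f => simp only [blackCount, blackCount_append]; omega
  | child c f _ ih => cases c <;> simp only [blackCount] <;> omega
  | tail c g _ ih => cases c <;> simp only [blackCount] <;> omega

theorem eq_or_blackCount_lt_of_reflTransGen {f f' : DupForest}
    (h : Relation.ReflTransGen Step f f') : f = f' ∨ f.blackCount < f'.blackCount := by
  induction h with
  | refl => exact Or.inl rfl
  | tail _ hs ih =>
    rcases ih with rfl | ih
    · exact Or.inr hs.blackCount_lt
    · exact Or.inr (ih.trans hs.blackCount_lt)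

/-- The poset of duplicative forests: the reflexive and transitive closure of `Step`. The poset
of the forests above a forest `f` is `Set.Ici f`. -/
instance : PartialOrder DupForest where
  le := Relation.ReflTransGen Step
  le_refl _ := Relation.ReflTransGen.refl
  le_trans _ _ _ h₁ h₂ := h₁.trans h₂
  le_antisymm f f' h₁ h₂ := by
    rcases eq_or_blackCount_lt_of_reflTransGen h₁ with h | h
    · exact h
    · rcases eq_or_blackCount_lt_of_reflTransGen h₂ with h' | h'
      · exact h'.symm
      · omega

end DupForest

end Mockingbird

namespace Mockingbird

/-! A forest is encoded as a term whose up-set has the same shape. The empty forest becomes a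
complete binary term, which is maximal. If `g`, `f` are encoded by `t`, `s`, a black node over `g`
followed by `f` becomes `t s`, and a white one becomes `(M t) s`: contracting `M t` to `t t` mirrors
blackening the node and duplicating `g`. Keeping encodings different from `M` prevents spurious
redexes (`nonempty_orderIso_black`, `nonempty_orderIso_white`). By induction, the encoding can be
placed above `r_d` for every large `d` (`exists_nonempty_orderIso_Ici`). Since M(d) has a greatest
element, the up-set of the encoding is a maximal interval. -/

/-- Two up-sets `Ici x` and `Ici y` parametrised by a common type, on which they induce the same
relation, are isomorphic. -/
theorem nonempty_orderIso_Ici {X Y Z : Type*} [PartialOrder X] [PartialOrder Y] {x : X} {y : Y}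
    (u : Z → X) (v : Z → Y) (hxu : ∀ z, x ≤ u z) (hyv : ∀ z, y ≤ v z)
    (hu : ∀ x', x ≤ x' → ∃ z, u z = x') (hv : ∀ y', y ≤ y' → ∃ z, v z = y')
    (h : ∀ a b, u a ≤ u b ↔ v a ≤ v b) : Nonempty (Set.Ici x ≃o Set.Ici y) := by
  choose s hs using fun a : Set.Ici x => hu a a.2
  have hle : ∀ a b : Set.Ici x, (⟨v (s a), hyv _⟩ : Set.Ici y) ≤ ⟨v (s b), hyv _⟩ ↔ a ≤ b :=
    fun a b => by
      change v (s a) ≤ v (s b) ↔ (a : X) ≤ b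
      rw [← h, hs, hs]
  refine ⟨RelIso.ofSurjective
    (OrderEmbedding.ofMapLEIff (fun a : Set.Ici x => (⟨v (s a), hyv _⟩ : Set.Ici y)) hle)
    ?_⟩
  rintro ⟨b, hb⟩
  obtain ⟨z, rfl⟩ := hv b hb
  -- The chosen parameter of `u z` may differ from `z`, but equal `u`-values force equal `v`-values
  -- by antisymmetry.
  have hz : u (s ⟨u z, hxu z⟩) = u z := hs ⟨u z, hxu z⟩
  exact ⟨⟨u z, hxu z⟩, Subtype.ext (le_antisymm ((h _ _).1 hz.le) ((h _ _).1 hz.ge))⟩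

/-! ### Up-sets of applications in the term order -/

namespace MTerm

theorem Step.le {t t' : MTerm} (h : Step t t') : t ≤ t' := Relation.ReflTransGen.single h

theorem app_le_app {t₁ t₂ s₁ s₂ : MTerm} (h₁ : t₁ ≤ s₁) (h₂ : t₂ ≤ s₂) :
    app t₁ t₂ ≤ app s₁ s₂ :=
  le_trans (Relation.ReflTransGen.lift (fun t => app t t₂) (fun _ _ h => Step.left t₂ h) _ _ h₁)
    (Relation.ReflTransGen.lift (app s₁) (fun _ _ h => Step.right s₁ h) _ _ h₂)

theorem app_M_le_app {t s₁ s₂ : MTerm} (h₁ : t ≤ s₁) (h₂ : t ≤ s₂) : app M t ≤ app s₁ s₂ :=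
  (Step.rule t).le.trans (app_le_app h₁ h₂)

/-- Every step produces an application. Hence a left factor other than `M` never creates a redex at
the root. -/
theorem ne_M_of_le {t s : MTerm} (h : t ≤ s) (ht : t ≠ M) : s ≠ M := by
  induction h with
  | refl => exact ht
  | tail _ hs _ => cases hs <;> simp

theorem eq_M_of_le_M {t : MTerm} (h : t ≤ M) : t = M :=
  by_contra fun ht => ne_M_of_le h ht rfl

theorem eq_M_of_M_le {s : MTerm} (h : M ≤ s) : s = M := by
  induction h with
  | refl => rfl
  | tail _ hs ih => subst ih; cases hs

theorem exists_of_app_le {t₁ t₂ x : MTerm} (h : app t₁ t₂ ≤ x) (ht : t₁ ≠ M) :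
    ∃ s₁ s₂, t₁ ≤ s₁ ∧ t₂ ≤ s₂ ∧ x = app s₁ s₂ := by
  induction h with
  | refl => exact ⟨t₁, t₂, le_rfl, le_rfl, rfl⟩
  | tail _ hs ih =>
    obtain ⟨s₁, s₂, h₁, h₂, rfl⟩ := ih
    cases hs with
    | rule => exact absurd rfl (ne_M_of_le h₁ ht)
    | left _ h => exact ⟨_, _, h₁.trans h.le, h₂, rfl⟩
    | right _ h => exact ⟨_, _, h₁, h₂.trans h.le, rfl⟩

theorem exists_of_app_M_le {t x : MTerm} (h : app M t ≤ x) :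
    (∃ s, t ≤ s ∧ x = app M s) ∨ ∃ s₁ s₂, t ≤ s₁ ∧ t ≤ s₂ ∧ x = app s₁ s₂ := by
  induction h with
  | refl => exact Or.inl ⟨t, le_rfl, rfl⟩
  | tail _ hs ih =>
    rcases ih with ⟨s, h, rfl⟩ | ⟨s₁, s₂, h₁, h₂, rfl⟩
    · cases hs with
      | rule => exact Or.inr ⟨_, _, h, h, rfl⟩
      | left _ h' => cases h'
      | right _ h' => exact Or.inl ⟨_, h.trans h'.le, rfl⟩
    · right
      cases hs with
      -- Here `s₁` is `M`, and the root redex replaces it by a second copy of `s₂`.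
      | rule => exact ⟨_, _, h₂, h₂, rfl⟩
      | left _ h => exact ⟨_, _, h₁.trans h.le, h₂, rfl⟩
      | right _ h => exact ⟨_, _, h₁, h₂.trans h.le, rfl⟩

theorem app_le_app_iff {t₁ t₂ s₁ s₂ : MTerm} (ht : t₁ ≠ M) :
    app t₁ t₂ ≤ app s₁ s₂ ↔ t₁ ≤ s₁ ∧ t₂ ≤ s₂ := by
  refine ⟨fun h => ?_, fun h => app_le_app h.1 h.2⟩
  obtain ⟨_, _, h₁, h₂, h⟩ := exists_of_app_le h ht
  cases h
  exact ⟨h₁, h₂⟩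

theorem app_M_le_app_iff {t s₁ s₂ : MTerm} (hs : s₁ ≠ M) :
    app M t ≤ app s₁ s₂ ↔ t ≤ s₁ ∧ t ≤ s₂ := by
  refine ⟨fun h => ?_, fun h => app_M_le_app h.1 h.2⟩
  rcases exists_of_app_M_le h with ⟨_, _, h⟩ | ⟨_, _, h₁, h₂, h⟩
  · cases h
    exact absurd rfl hs
  · cases h
    exact ⟨h₁, h₂⟩

theorem app_M_le_app_M_iff {t s : MTerm} (ht : t ≠ M) : app M t ≤ app M s ↔ t ≤ s := by
  refine ⟨fun h => ?_, fun h => app_le_app le_rfl h⟩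
  rcases exists_of_app_M_le h with ⟨_, h₁, h⟩ | ⟨_, _, h₁, _, h⟩
  · cases h
    exact h₁
  · cases h
    exact absurd rfl (ne_M_of_le h₁ ht)

/-- The complete binary combinator of height `d`, the greatest element of `M(d)`. -/
def complete : ℕ → MTerm
  | 0 => M
  | d + 1 => app (complete d) (complete d)

theorem le_complete {d : ℕ} {t : MTerm} (h : rightComb d ≤ t) : t ≤ complete d := by
  induction d generalizing t with
  | zero => exact (eq_M_of_M_le h).le
  | succ d ih =>
    rcases exists_of_app_M_le h with ⟨s, hs, rfl⟩ | ⟨s₁, s₂, h₁, h₂, rfl⟩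
    · exact app_M_le_app (ih hs) (ih hs)
    · exact app_le_app (ih h₁) (ih h₂)

theorem rightComb_le_complete (d : ℕ) : rightComb d ≤ complete d := le_complete le_rfl

end MTerm

/-! ### Up-sets in the forest order -/

namespace DupForest

theorem Step.le {f f' : DupForest} (h : Step f f') : f ≤ f' := Relation.ReflTransGen.single h

theorem cons_le_cons (c : Color) {g g' f f' : DupForest} (hg : g ≤ g') (hf : f ≤ f') :
    cons c g f ≤ cons c g' f' :=
  le_trans (Relation.ReflTransGen.lift (fun x => cons c x f) (fun _ _ h => Step.child c f h) _ _ hg)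
    (Relation.ReflTransGen.lift (cons c g') (fun _ _ h => Step.tail c g' h) _ _ hf)

theorem append_le_append {g g' f f' : DupForest} (hg : g ≤ g') (hf : f ≤ f') :
    append g f ≤ append g' f' := by
  have hl : append g f ≤ append g f' := by
    clear hg
    induction g with
    | nil => exact hf
    | cons c g h _ ih => exact cons_le_cons c le_rfl ih
  refine hl.trans (Relation.ReflTransGen.lift (fun x => append x f') (fun _ _ h => ?_) _ _ hg)
  change Step (append _ f') (append _ f')
  induction h with
  | dup g f => exact Step.dup g (append f f')
  | child c f h _ => exact Step.child c _ h
  | tail c g _ ih => exact Step.tail c g ih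

/-- Number of trees of a forest. -/
def length : DupForest → ℕ
  | nil => 0
  | cons _ _ f => length f + 1

/-- Duplication occurs below a node, so the top-level word keeps its length. This locates the cut
between the two copies made by a duplication. -/
theorem Step.length_eq {f f' : DupForest} (h : Step f f') : f.length = f'.length := by
  induction h with
  | dup => rfl
  | child => rfl
  | tail _ _ _ ih => simp only [length, ih]

theorem length_eq_of_le {f f' : DupForest} (h : f ≤ f') : f.length = f'.length := by
  induction h with
  | refl => rfl
  | tail _ hs ih => exact ih.trans hs.length_eq

theorem append_inj {g g' f f' : DupForest} (h : append g f = append g' f')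
    (hl : g.length = g'.length) : g = g' ∧ f = f' := by
  induction g generalizing g' with
  | nil =>
    cases g' with
    | nil => exact ⟨rfl, h⟩
    | cons => simp [length] at hl
  | cons c k g _ ih =>
    cases g' with
    | nil => simp [length] at hl
    | cons c' k' g' =>
      simp only [append, cons.injEq] at h
      simp only [length, add_left_inj] at hl
      obtain ⟨rfl, rfl, h⟩ := h
      obtain ⟨rfl, rfl⟩ := ih h hl
      exact ⟨rfl, rfl⟩

theorem Step.exists_of_append {g f x : DupForest} (h : Step (append g f) x) :
    ∃ g' f', g ≤ g' ∧ f ≤ f' ∧ x = append g' f' := by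
  induction g generalizing x with
  | nil => exact ⟨nil, x, le_rfl, h.le, rfl⟩
  | cons c k g _ ih =>
    cases h with
    | dup => exact ⟨_, f, (Step.dup k g).le, le_rfl, rfl⟩
    | child _ _ h => exact ⟨_, f, (Step.child c g h).le, le_rfl, rfl⟩
    | tail _ _ h =>
      obtain ⟨g', f', hg, hf, rfl⟩ := ih h
      exact ⟨cons c k g', f', cons_le_cons c le_rfl hg, hf, rfl⟩

theorem exists_of_append_le {g f x : DupForest} (h : append g f ≤ x) :
    ∃ g' f', g ≤ g' ∧ f ≤ f' ∧ x = append g' f' := by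
  induction h with
  | refl => exact ⟨g, f, le_rfl, le_rfl, rfl⟩
  | tail _ hs ih =>
    obtain ⟨g', f', hg, hf, rfl⟩ := ih
    obtain ⟨g'', f'', hg', hf', rfl⟩ := hs.exists_of_append
    exact ⟨g'', f'', hg.trans hg', hf.trans hf', rfl⟩

theorem append_le_append_iff {g g' f f' : DupForest} (hl : g.length = g'.length) :
    append g f ≤ append g' f' ↔ g ≤ g' ∧ f ≤ f' := by
  refine ⟨fun h => ?_, fun h => append_le_append h.1 h.2⟩
  obtain ⟨_, _, hg, hf, h⟩ := exists_of_append_le h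
  obtain ⟨rfl, rfl⟩ := append_inj h (hl.symm.trans (length_eq_of_le hg))
  exact ⟨hg, hf⟩

theorem eq_nil_of_nil_le {f : DupForest} (h : nil ≤ f) : f = nil := by
  induction h with
  | refl => rfl
  | tail _ hs ih => subst ih; cases hs

theorem exists_of_black_le {g f x : DupForest} (h : cons Color.black g f ≤ x) :
    ∃ g' f', g ≤ g' ∧ f ≤ f' ∧ x = cons Color.black g' f' := by
  induction h with
  | refl => exact ⟨g, f, le_rfl, le_rfl, rfl⟩
  | tail _ hs ih =>
    obtain ⟨g', f', hg, hf, rfl⟩ := ih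
    cases hs with
    | child _ _ h => exact ⟨_, _, hg.trans h.le, hf, rfl⟩
    | tail _ _ h => exact ⟨_, _, hg, hf.trans h.le, rfl⟩

/-- Once the node is black, no step mixes the two copies, so they evolve independently. -/
theorem exists_of_white_le {g f x : DupForest} (h : cons Color.white g f ≤ x) :
    (∃ g' f', g ≤ g' ∧ f ≤ f' ∧ x = cons Color.white g' f') ∨
      ∃ g₁ g₂ f', g ≤ g₁ ∧ g ≤ g₂ ∧ f ≤ f' ∧ x = cons Color.black (append g₁ g₂) f' := by
  induction h with
  | refl => exact Or.inl ⟨g, f, le_rfl, le_rfl, rfl⟩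
  | tail _ hs ih =>
    rcases ih with ⟨g', f', hg, hf, rfl⟩ | ⟨g₁, g₂, f', h₁, h₂, hf, rfl⟩
    · cases hs with
      | dup => exact Or.inr ⟨_, _, _, hg, hg, hf, rfl⟩
      | child _ _ h => exact Or.inl ⟨_, _, hg.trans h.le, hf, rfl⟩
      | tail _ _ h => exact Or.inl ⟨_, _, hg, hf.trans h.le, rfl⟩
    · right
      cases hs with
      | child _ _ h =>
        obtain ⟨g₁', g₂', h₁', h₂', rfl⟩ := h.exists_of_append
        exact ⟨_, _, _, h₁.trans h₁', h₂.trans h₂', hf, rfl⟩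
      | tail _ _ h => exact ⟨_, _, _, h₁, h₂, hf.trans h.le, rfl⟩

theorem cons_le_cons_iff {c : Color} {g g' f f' : DupForest} :
    cons c g f ≤ cons c g' f' ↔ g ≤ g' ∧ f ≤ f' := by
  refine ⟨fun h => ?_, fun h => cons_le_cons c h.1 h.2⟩
  cases c with
  | black =>
    obtain ⟨_, _, hg, hf, h⟩ := exists_of_black_le h
    cases h
    exact ⟨hg, hf⟩
  | white =>
    rcases exists_of_white_le h with ⟨_, _, hg, hf, h⟩ | ⟨_, _, _, _, _, _, h⟩
    · cases h
      exact ⟨hg, hf⟩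
    · cases h

theorem white_le_black {g g₁ g₂ f f' : DupForest} (h₁ : g ≤ g₁) (h₂ : g ≤ g₂) (hf : f ≤ f') :
    cons Color.white g f ≤ cons Color.black (append g₁ g₂) f' :=
  (Step.dup g f).le.trans (cons_le_cons _ (append_le_append h₁ h₂) hf)

theorem white_le_black_iff {g g₁ g₂ f f' : DupForest} (hl : g.length = g₁.length) :
    cons Color.white g f ≤ cons Color.black (append g₁ g₂) f' ↔
      (g ≤ g₁ ∧ g ≤ g₂) ∧ f ≤ f' := by
  refine ⟨fun h => ?_, fun h => white_le_black h.1.1 h.1.2 h.2⟩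
  rcases exists_of_white_le h with ⟨_, _, _, _, h⟩ | ⟨_, _, _, h₁, h₂, hf, h⟩
  · cases h
  · simp only [cons.injEq, true_and] at h
    obtain ⟨h, rfl⟩ := h
    obtain ⟨rfl, rfl⟩ := append_inj h (hl.symm.trans (length_eq_of_le h₁))
    exact ⟨⟨h₁, h₂⟩, hf⟩

theorem not_black_le_white {g g' f f' : DupForest} :
    ¬ cons Color.black g f ≤ cons Color.white g' f' := by
  intro h
  obtain ⟨_, _, _, _, h⟩ := exists_of_black_le h
  cases h

end DupForest

/-! ### Encoding forests by terms -/

open MTerm DupForest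

theorem nonempty_orderIso_black {g f : DupForest} {t s : MTerm} (ht : t ≠ M)
    (e₁ : Set.Ici g ≃o Set.Ici t) (e₂ : Set.Ici f ≃o Set.Ici s) :
    Nonempty (Set.Ici (cons Color.black g f) ≃o Set.Ici (app t s)) := by
  have h₁ : ∀ a b, (e₁ a : MTerm) ≤ e₁ b ↔ (a : DupForest) ≤ b := fun _ _ => e₁.le_iff_le
  have h₂ : ∀ a b, (e₂ a : MTerm) ≤ e₂ b ↔ (a : DupForest) ≤ b := fun _ _ => e₂.le_iff_le
  refine nonempty_orderIso_Ici (Z := Set.Ici g × Set.Ici f)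
    (fun p => cons Color.black p.1 p.2) (fun p => app (e₁ p.1) (e₂ p.2))
    (fun p => cons_le_cons _ p.1.2 p.2.2) (fun p => app_le_app (e₁ p.1).2 (e₂ p.2).2) ?_ ?_ ?_
  · intro x hx
    obtain ⟨g', f', hg, hf, rfl⟩ := exists_of_black_le hx
    exact ⟨(⟨g', hg⟩, ⟨f', hf⟩), rfl⟩
  · intro x hx
    obtain ⟨t', s', ht', hs', rfl⟩ := exists_of_app_le hx ht
    exact ⟨(e₁.symm ⟨t', ht'⟩, e₂.symm ⟨s', hs'⟩), by simp⟩
  · rintro ⟨a, b⟩ ⟨a', b'⟩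
    simp only [cons_le_cons_iff, app_le_app_iff (ne_M_of_le (e₁ a).2 ht), h₁, h₂]

theorem nonempty_orderIso_white {g f : DupForest} {t s : MTerm} (ht : t ≠ M)
    (e₁ : Set.Ici g ≃o Set.Ici t) (e₂ : Set.Ici f ≃o Set.Ici s) :
    Nonempty (Set.Ici (cons Color.white g f) ≃o Set.Ici (app (app M t) s)) := by
  have h₁ : ∀ a b, (e₁ a : MTerm) ≤ e₁ b ↔ (a : DupForest) ≤ b := fun _ _ => e₁.le_iff_le
  have h₂ : ∀ a b, (e₂ a : MTerm) ≤ e₂ b ↔ (a : DupForest) ≤ b := fun _ _ => e₂.le_iff_le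
  have hM : ∀ a : Set.Ici g, (e₁ a : MTerm) ≠ M := fun a => ne_M_of_le (e₁ a).2 ht
  have hl : ∀ a b : Set.Ici g, (a : DupForest).length = (b : DupForest).length := fun a b =>
    (length_eq_of_le a.2).symm.trans (length_eq_of_le b.2)
  have hn : ∀ x y : MTerm, app x y ≠ M := by simp
  -- The left summand records states before the duplication, the right one the pair of copies after
  -- it.
  refine nonempty_orderIso_Ici (Z := (Set.Ici g ⊕ Set.Ici g × Set.Ici g) × Set.Ici f)
    (fun p => Sum.elim (fun a : Set.Ici g => cons Color.white a p.2)
      (fun a : Set.Ici g × Set.Ici g => cons Color.black (append a.1 a.2) p.2) p.1)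
    (fun p => Sum.elim (fun a : Set.Ici g => app (app M (e₁ a)) (e₂ p.2))
      (fun a : Set.Ici g × Set.Ici g => app (app (e₁ a.1) (e₁ a.2)) (e₂ p.2)) p.1)
    ?_ ?_ ?_ ?_ ?_
  · rintro ⟨a | a, b⟩
    · exact cons_le_cons _ a.2 b.2
    · exact white_le_black a.1.2 a.2.2 b.2
  · rintro ⟨a | a, b⟩
    · exact app_le_app (app_le_app le_rfl (e₁ a).2) (e₂ b).2
    · exact app_le_app (app_M_le_app (e₁ a.1).2 (e₁ a.2).2) (e₂ b).2
  · intro x hx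
    rcases exists_of_white_le hx with ⟨g', f', hg, hf, rfl⟩ | ⟨g₁, g₂, f', hg₁, hg₂, hf, rfl⟩
    · exact ⟨(Sum.inl ⟨g', hg⟩, ⟨f', hf⟩), rfl⟩
    · exact ⟨(Sum.inr (⟨g₁, hg₁⟩, ⟨g₂, hg₂⟩), ⟨f', hf⟩), rfl⟩
  · intro x hx
    obtain ⟨y, s', hy, hs, rfl⟩ := exists_of_app_le hx (hn _ _)
    rcases exists_of_app_M_le hy with ⟨t', ht', rfl⟩ | ⟨t₁, t₂, ht₁, ht₂, rfl⟩
    · exact ⟨(Sum.inl (e₁.symm ⟨t', ht'⟩), e₂.symm ⟨s', hs⟩), by simp⟩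
    · exact ⟨(Sum.inr (e₁.symm ⟨t₁, ht₁⟩, e₁.symm ⟨t₂, ht₂⟩), e₂.symm ⟨s', hs⟩), by simp⟩
  · rintro ⟨a | ⟨a₁, a₂⟩, b⟩ ⟨a' | ⟨a₁', a₂'⟩, b'⟩
    · simp only [Sum.elim_inl, cons_le_cons_iff, app_le_app_iff (hn _ _),
        app_M_le_app_M_iff (hM _), h₁, h₂]
    · simp only [Sum.elim_inl, Sum.elim_inr, white_le_black_iff (hl _ _),
        app_le_app_iff (hn _ _), app_M_le_app_iff (hM _), h₁, h₂]
    · simp only [Sum.elim_inl, Sum.elim_inr, not_black_le_white, app_le_app_iff (hn _ _),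
        app_le_app_iff (hM _), false_iff]
      exact fun h => hM _ (eq_M_of_le_M h.1.1)
    · simp only [Sum.elim_inr, cons_le_cons_iff, append_le_append_iff (hl _ _),
        app_le_app_iff (hn _ _), app_le_app_iff (hM _), h₁, h₂]

/-- Asking for all large `d` lets the encodings of subtrees and siblings be taken at the heights
that a common comb imposes. -/
theorem exists_nonempty_orderIso_Ici (f : DupForest) :
    ∃ n, ∀ d, n ≤ d → ∃ t, rightComb d ≤ t ∧ t ≠ M ∧ Nonempty (Set.Ici f ≃o Set.Ici t) := by
  induction f with
  | nil =>
    -- Height 0 is excluded because `complete 0` is `M`.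
    refine ⟨1, fun d hd => ⟨complete d, rightComb_le_complete d, ?_, ?_⟩⟩
    · obtain ⟨d, rfl⟩ := Nat.exists_eq_add_of_le' hd
      simp [complete]
    · exact nonempty_orderIso_Ici (Z := Unit) (fun _ => nil) (fun _ => complete d)
        (fun _ => le_rfl) (fun _ => le_rfl) (fun _ hx => ⟨(), (eq_nil_of_nil_le hx).symm⟩)
        (fun _ hx => ⟨(), le_antisymm hx (le_complete ((rightComb_le_complete d).trans hx))⟩)
        (by simp)
  | cons c g f ihg ihf =>
    obtain ⟨m, hm⟩ := ihg
    obtain ⟨n, hn⟩ := ihf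
    -- A white node uses two levels of the comb: `M (M r_d)` duplicates to `(M r_d) (M r_d)`, whose
    -- factors grow to `M t` and `s`.
    refine ⟨m + n + 2, fun d hd => ?_⟩
    obtain ⟨d, rfl⟩ := Nat.exists_eq_add_of_le' (show 2 ≤ d by omega)
    obtain ⟨s, hs, -, ⟨e₂⟩⟩ := hn (d + 1) (by omega)
    cases c with
    | black =>
      obtain ⟨t, ht, htM, ⟨e₁⟩⟩ := hm (d + 1) (by omega)
      exact ⟨app t s, app_M_le_app ht hs, by simp, nonempty_orderIso_black htM e₁ e₂⟩
    | white =>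
      obtain ⟨t, ht, htM, ⟨e₁⟩⟩ := hm d (by omega)
      exact ⟨app (app M t) s, app_M_le_app (app_le_app le_rfl ht) hs, by simp,
        nonempty_orderIso_white htM e₁ e₂⟩

end Mockingbird

theorem mainTheorem4 (f : Mockingbird.DupForest) :
    ∃ (d : ℕ) (a b : Mockingbird.MockingbirdLattice d),
      a ≤ b ∧ IsTop b ∧ Nonempty (Set.Ici f ≃o Set.Icc a b) := by
  obtain ⟨d, h⟩ := Mockingbird.exists_nonempty_orderIso_Ici f
  obtain ⟨t, ht, -, ⟨e⟩⟩ := h d le_rfl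
  have htop : IsTop (⟨_, Mockingbird.MTerm.rightComb_le_complete d⟩ :
      Mockingbird.MockingbirdLattice d) := fun x => Mockingbird.MTerm.le_complete x.2
  refine ⟨d, ⟨t, ht⟩, _, htop _, htop, ⟨e.trans ?_⟩⟩
  -- Terms above `t` automatically lie in M(d) and below its top.
  exact
    { toFun := fun x => ⟨⟨x, ht.trans x.2⟩, x.2, htop _⟩
      invFun := fun x => ⟨x, x.2.1⟩
      left_inv := fun _ => rfl
      right_inv := fun _ => rfl
      map_rel_iff' := Iff.rfl }
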